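/- Let $\mathcal A$ be a central hyperplane arrangement, i.e. a finite set of linear hyperplanes in a finite-dimensional real Euclidean space $V$, with a nonzero normal vector $e_H$ chosen for each $H\in\mathcal A$. Put $H^{+}=\{v:\langle e_H,v\rangle\ge 0\}$, $H^{-}=\{v:\langle e_H,v\rangle\le 0\}$ and $H^{0}=H$. The regions of $\mathcal A$ are the closures of the connected components of $V\setminus\bigcup_{H\in\mathcal A}H$, and the faces are the intersections of nonempty families of regions; $\dim X$ is the dimension of the linear span of a face $X$. The covector of a face $X$ is $X(H)=\operatorname{sign}\langle e_H,v\rangle\in\{-,0,+\}$, $H\in\mathcal A$, for any $v$ in the relative interior of $X$; one has $X=\bigcap_{H}H^{X(H)}$. For faces $X,Z$ let $X_{-Z}$ be the sign vector with $X_{-Z}(H)=-X(H)$ if $Z(H)=0$ and $X_{-Z}(H)=X(H)$ otherwise, and write $X_{-Z}$ also for the set $\bigcap_H H^{X_{-Z}(H)}$ (a face whenever $Z\subseteq X$). Fix a base region $B$. Order the regions by $R\le_B R'$ if and only if every $H\in\mathcal A$ that separates $B$ from $R$ also separates $B$ from $R'$. For every face $F$ the set of regions containing $F$ is an interval $[m_F,M_F]$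 of this poset. The facial weak order is the partial order on the set of faces given by $$F\le G\iff m_F\le_B m_G\ \text{ and }\ M_F\le_B M_G .$$ Let $\mu$ be its Möbius function: $\mu(X,X)=1$, $\mu(X,Y)=-\sum_{X\le W<Y}\mu(X,W)$ if $X<Y$, and $\mu(X,Y)=0$ if $X\not\le Y$. Let $X,Y$ be faces with $X\le Y$ in the facial weak order, and let $Z=X\cap Y$. Then $$\mu(X,Y)=\begin{cases}(-1)^{\dim X+\dim Y} & \text{if } X\le Z\le Y \text{ and } Z=X_{-Z}\cap Y,\\ 0 & \text{otherwise.}\end{cases}$$ -/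

import Mathlib

open scoped RealInnerProductSpace

/-- A (central) hyperplane arrangement in a Euclidean space `V`: a finite set of linear
hyperplanes, with a chosen nonzero normal vector for each of them. No orientation of the normal
vectors is imposed, so every choice of them is allowed. -/
structure HyperplaneArrangement (V : Type*) [NormedAddCommGroup V] [InnerProductSpace ℝ V] where
  /-- The hyperplanes of the arrangement. -/
  hyperplanes : Finset (Submodule ℝ V)
  /-- The chosen normal vectors. -/
  normal : hyperplanes → V
  normal_ne_zero : ∀ H, normal H ≠ 0
  mem_iff : ∀ (H : hyperplanes) (v : V), v ∈ (H : Submodule ℝ V) ↔ ⟪normal H, v⟫ = 0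

namespace HyperplaneArrangement

variable {V : Type*} [NormedAddCommGroup V] [InnerProductSpace ℝ V]

/-- The complement of the union of the hyperplanes. -/
def complement (A : HyperplaneArrangement V) : Set V :=
  {v | ∀ H : A.hyperplanes, v ∉ (H : Submodule ℝ V)}

/-- A region: the closure of a connected component of the complement of the hyperplanes. -/
structure Region (A : HyperplaneArrangement V) where
  /-- The underlying set. -/
  carrier : Set V
  isRegion : ∃ x ∈ A.complement, carrier = closure (connectedComponentIn A.complement x)

/-- A face: the intersection of a nonempty family of regions. -/
structure Face (A : HyperplaneArrangement V) where
  /-- The underlying set. -/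
  carrier : Set V
  isFace : ∃ 𝓡 : Set A.Region, 𝓡.Nonempty ∧ carrier = ⋂ R ∈ 𝓡, R.carrier

/-- The sign map `σ : V → {-, 0, +}^A`. -/
noncomputable def signMap (A : HyperplaneArrangement V) (v : V) : A.hyperplanes → SignType :=
  fun H => SignType.sign ⟪A.normal H, v⟫

/-- `H^+`, `H^-` (closed half-spaces) and `H^0 = H`. -/
def halfSpace (A : HyperplaneArrangement V) (H : A.hyperplanes) : SignType → Set V
  | .pos => {v | 0 ≤ ⟪A.normal H, v⟫}
  | .neg => {v | ⟪A.normal H, v⟫ ≤ 0}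
  | .zero => {v | v ∈ (H : Submodule ℝ V)}

/-- The set `⋂_H H^{σ(H)}` given by a sign vector; a face is recovered in this way from its
covector. -/
def cell (A : HyperplaneArrangement V) (σ : A.hyperplanes → SignType) : Set V :=
  ⋂ H, A.halfSpace H (σ H)

/-- The hyperplane `H` separates the sets `R` and `R'`: they lie on opposite sides of `H`. -/
def Separates (A : HyperplaneArrangement V) (H : A.hyperplanes) (R R' : Set V) : Prop :=
  (R ⊆ A.halfSpace H 1 ∧ R' ⊆ A.halfSpace H (-1)) ∨
    (R ⊆ A.halfSpace H (-1) ∧ R' ⊆ A.halfSpace H 1)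

/-- The separation set `S(R, R')` of two regions. -/
def separationSet (A : HyperplaneArrangement V) (R R' : A.Region) : Set A.hyperplanes :=
  {H | A.Separates H R.carrier R'.carrier}

/-! ### Facts needed for the orders below to be well defined -/

section Facts

variable {A : HyperplaneArrangement V}

theorem mem_halfSpace {H : A.hyperplanes} {s : SignType} {v : V} :
    v ∈ A.halfSpace H s ↔
      (0 ≤ s → 0 ≤ ⟪A.normal H, v⟫) ∧ (s ≤ 0 → ⟪A.normal H, v⟫ ≤ 0) := by
  cases s
  · change v ∈ (H : Submodule ℝ V) ↔ _
    have h1 : (0 : SignType) ≤ SignType.zero := by decide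
    have h2 : SignType.zero ≤ 0 := by decide
    rw [A.mem_iff]
    simp only [h1, h2, true_imp_iff]
    exact ⟨fun h => ⟨h.ge, h.le⟩, fun h => le_antisymm h.2 h.1⟩
  · change ⟪A.normal H, v⟫ ≤ 0 ↔ _
    have h1 : ¬ (0 : SignType) ≤ SignType.neg := by decide
    have h2 : SignType.neg ≤ 0 := by decide
    simp only [h1, h2, true_imp_iff, false_imp_iff, true_and]
  · change 0 ≤ ⟪A.normal H, v⟫ ↔ _
    have h1 : (0 : SignType) ≤ SignType.pos := by decide
    have h2 : ¬ SignType.pos ≤ 0 := by decide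
    simp only [h1, h2, true_imp_iff, false_imp_iff, and_true]

theorem mem_cell {σ : A.hyperplanes → SignType} {v : V} :
    v ∈ A.cell σ ↔ ∀ H,
      (0 ≤ σ H → 0 ≤ ⟪A.normal H, v⟫) ∧ (σ H ≤ 0 → ⟪A.normal H, v⟫ ≤ 0) := by
  simp only [cell, Set.mem_iInter, mem_halfSpace]

theorem mem_cell_signMap {x v : V} :
    v ∈ A.cell (A.signMap x) ↔ ∀ H,
      (0 ≤ ⟪A.normal H, x⟫ → 0 ≤ ⟪A.normal H, v⟫) ∧
        (⟪A.normal H, x⟫ ≤ 0 → ⟪A.normal H, v⟫ ≤ 0) := by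
  simp only [mem_cell, signMap, sign_nonneg_iff, sign_nonpos_iff]

theorem mem_cell_self (x : V) : x ∈ A.cell (A.signMap x) :=
  mem_cell_signMap.2 fun _ => ⟨id, id⟩

theorem zero_mem_cell (σ : A.hyperplanes → SignType) : (0 : V) ∈ A.cell σ :=
  mem_cell.2 fun H => by simp

theorem inner_comb (e x y : V) (a b : ℝ) : ⟪e, a • x + b • y⟫ = a * ⟪e, x⟫ + b * ⟪e, y⟫ := by
  rw [inner_add_right, inner_smul_right, inner_smul_right]

theorem convex_cell (σ : A.hyperplanes → SignType) : Convex ℝ (A.cell σ) := by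
  intro x hx y hy a b ha hb _
  rw [mem_cell] at *
  intro H
  rw [inner_comb]
  exact ⟨fun h => add_nonneg (mul_nonneg ha ((hx H).1 h)) (mul_nonneg hb ((hy H).1 h)),
    fun h => add_nonpos (mul_nonpos_of_nonneg_of_nonpos ha ((hx H).2 h))
      (mul_nonpos_of_nonneg_of_nonpos hb ((hy H).2 h))⟩

theorem isClosed_cell (σ : A.hyperplanes → SignType) : IsClosed (A.cell σ) := by
  have : A.cell σ = ⋂ H, {v | (0 ≤ σ H → 0 ≤ ⟪A.normal H, v⟫) ∧
      (σ H ≤ 0 → ⟪A.normal H, v⟫ ≤ 0)} := by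
    ext v; simp [mem_cell]
  rw [this]
  refine isClosed_iInter fun H => ?_
  have hc : Continuous fun v : V => ⟪A.normal H, v⟫ := by fun_prop
  rcases lt_trichotomy (σ H) 0 with h | h | h
  · simpa [h.not_ge, h.le] using isClosed_le hc continuous_const
  · simp only [h, le_refl, true_imp_iff]
    exact (isClosed_le continuous_const hc).inter (isClosed_le hc continuous_const)
  · simpa [h.not_ge, h.le] using isClosed_le continuous_const hc

theorem mem_complement {x : V} : x ∈ A.complement ↔ ∀ H, ⟪A.normal H, x⟫ ≠ 0 :=
  forall_congr' fun H => not_congr (A.mem_iff H x)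

theorem connectedComponentIn_eq {x : V} (hx : x ∈ A.complement) :
    connectedComponentIn A.complement x = {y | A.signMap y = A.signMap x} := by
  have hx' := mem_complement.1 hx
  apply Set.Subset.antisymm
  · intro y hy
    funext H
    have hpre : IsPreconnected ((fun v : V => ⟪A.normal H, v⟫) ''
        connectedComponentIn A.complement x) :=
      isPreconnected_connectedComponentIn.image _ (by fun_prop)
    have hord := hpre.ordConnected
    have hxm := Set.mem_image_of_mem (fun v : V => ⟪A.normal H, v⟫)
      (mem_connectedComponentIn hx)
    have hym := Set.mem_image_of_mem (fun v : V => ⟪A.normal H, v⟫) hy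
    have h0 : (0 : ℝ) ∉ (fun v : V => ⟪A.normal H, v⟫) ''
        connectedComponentIn A.complement x := by
      rintro ⟨z, hz, hz0⟩
      exact mem_complement.1 (connectedComponentIn_subset _ _ hz) H hz0
    have hy0 := mem_complement.1 (connectedComponentIn_subset _ _ hy) H
    simp only [signMap]
    rcases lt_or_gt_of_ne (hx' H) with h | h <;> rcases lt_or_gt_of_ne hy0 with h' | h'
    · rw [sign_neg h, sign_neg h']
    · exact absurd (hord.out hxm hym ⟨h.le, h'.le⟩) h0
    · exact absurd (hord.out hym hxm ⟨h'.le, h.le⟩) h0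
    · rw [sign_pos h, sign_pos h']
  · have hconv : Convex ℝ {y | A.signMap y = A.signMap x} := by
      intro y hy z hz a b ha hb hab
      funext H
      have h1 := congrFun hy H
      have h2 := congrFun hz H
      simp only [signMap] at h1 h2 ⊢
      rw [inner_comb]
      rcases lt_or_gt_of_ne (hx' H) with h | h
      · rw [sign_neg h] at *
        rw [sign_eq_neg_one_iff] at *
        rcases ha.eq_or_lt with rfl | ha
        · have : b = 1 := by linarith
          subst this; linarith
        · have := mul_neg_of_pos_of_neg ha h1
          have := mul_nonpos_of_nonneg_of_nonpos hb h2.le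
          linarith
      · rw [sign_pos h] at *
        rw [sign_eq_one_iff] at *
        rcases ha.eq_or_lt with rfl | ha
        · have : b = 1 := by linarith
          subst this; linarith
        · have := mul_pos ha h1
          have := mul_nonneg hb h2.le
          linarith
    refine hconv.isPreconnected.subset_connectedComponentIn rfl fun y hy => ?_
    rw [mem_complement]
    intro H h0
    have h1 := congrFun hy H
    simp only [signMap, h0, sign_zero] at h1
    exact hx' H (sign_eq_zero_iff.1 h1.symm)

theorem closure_component_eq {x : V} (hx : x ∈ A.complement) :
    closure (connectedComponentIn A.complement x) = A.cell (A.signMap x) := by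
  rw [connectedComponentIn_eq hx]
  apply Set.Subset.antisymm
  · refine closure_minimal (fun y hy => ?_) (isClosed_cell _)
    have : A.signMap y = A.signMap x := hy
    rw [← this]
    exact mem_cell_self y
  · intro y hy
    rw [mem_cell_signMap] at hy
    have ht : Filter.Tendsto (fun t : ℝ => y + t • x) (nhdsWithin 0 (Set.Ioi 0)) (nhds y) := by
      have : Continuous fun t : ℝ => y + t • x := by fun_prop
      simpa using (this.tendsto 0).mono_left nhdsWithin_le_nhds
    refine mem_closure_of_tendsto ht ?_
    filter_upwards [self_mem_nhdsWithin] with t ht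
    have ht : 0 < t := ht
    funext H
    simp only [signMap, inner_add_right, inner_smul_right]
    rcases lt_or_gt_of_ne (mem_complement.1 hx H) with h | h
    · rw [sign_neg h, sign_eq_neg_one_iff]
      have := (hy H).2 h.le
      have := mul_neg_of_pos_of_neg ht h
      linarith
    · rw [sign_pos h, sign_eq_one_iff]
      have := (hy H).1 h.le
      have := mul_pos ht h
      linarith

theorem Region.ext' {R R' : A.Region} (h : R.carrier = R'.carrier) : R = R' := by
  cases R; cases R'; cases h; rfl

theorem Face.ext' {F G : A.Face} (h : F.carrier = G.carrier) : F = G := by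
  cases F; cases G; cases h; rfl

theorem Region.exists_point (R : A.Region) :
    ∃ x ∈ A.complement, R.carrier = A.cell (A.signMap x) := by
  obtain ⟨x, hx, h⟩ := R.isRegion
  exact ⟨x, hx, h.trans (closure_component_eq hx)⟩

/-- A point of the interior of the region `R`. -/
noncomputable def Region.point (R : A.Region) : V := R.exists_point.choose

theorem Region.point_mem (R : A.Region) : R.point ∈ A.complement := R.exists_point.choose_spec.1

theorem Region.carrier_eq (R : A.Region) : R.carrier = A.cell (A.signMap R.point) :=
  R.exists_point.choose_spec.2

theorem signMap_ne_zero {x : V} (hx : x ∈ A.complement) (H : A.hyperplanes) :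
    A.signMap x H ≠ 0 := fun h => mem_complement.1 hx H (sign_eq_zero_iff.1 h)

theorem exists_region {x : V} (hx : x ∈ A.complement) :
    ∃ R : A.Region, A.signMap R.point = A.signMap x := by
  let R : A.Region := ⟨A.cell (A.signMap x), x, hx, (closure_component_eq hx).symm⟩
  refine ⟨R, ?_⟩
  have h : R.point ∈ A.cell (A.signMap x) := by
    have : R.carrier = A.cell (A.signMap x) := rfl
    rw [← this, R.carrier_eq]
    exact mem_cell_self _
  rw [mem_cell_signMap] at h
  funext H
  simp only [signMap]
  have h0 := mem_complement.1 R.point_mem H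
  rcases lt_or_gt_of_ne (mem_complement.1 hx H) with h' | h'
  · rw [sign_neg h', sign_neg (lt_of_le_of_ne ((h H).2 h'.le) h0)]
  · rw [sign_pos h', sign_pos (lt_of_le_of_ne ((h H).1 h'.le) h0.symm)]

theorem mem_separationSet {R R' : A.Region} {H : A.hyperplanes} :
    H ∈ A.separationSet R R' ↔ A.signMap R'.point H ≠ A.signMap R.point H := by
  have key : ∀ Q : A.Region, (Q.carrier ⊆ A.halfSpace H 1 ↔ A.signMap Q.point H = 1) ∧
      (Q.carrier ⊆ A.halfSpace H (-1) ↔ A.signMap Q.point H = -1) := by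
    intro Q
    have h0 := mem_complement.1 Q.point_mem H
    rw [Q.carrier_eq]
    refine ⟨⟨fun h => ?_, fun h v hv => ?_⟩, ⟨fun h => ?_, fun h v hv => ?_⟩⟩
    · have := (mem_halfSpace.1 (h (mem_cell_self Q.point))).1 (by decide)
      exact sign_pos (lt_of_le_of_ne this h0.symm)
    · have := Set.mem_iInter.1 hv H
      rwa [h] at this
    · have := (mem_halfSpace.1 (h (mem_cell_self Q.point))).2 (by decide)
      exact sign_neg (lt_of_le_of_ne this h0)
    · have := Set.mem_iInter.1 hv H
      rwa [h] at this
  have h1 := signMap_ne_zero R.point_mem H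
  have h2 := signMap_ne_zero R'.point_mem H
  change A.Separates H R.carrier R'.carrier ↔ _
  simp only [Separates, (key R).1, (key R).2, (key R').1,
    (key R').2]
  revert h1 h2
  generalize A.signMap R.point H = s
  generalize A.signMap R'.point H = t
  revert s t
  decide

theorem Region.ext_sign {R R' : A.Region} (h : A.signMap R.point = A.signMap R'.point) :
    R = R' := Region.ext' (by rw [R.carrier_eq, R'.carrier_eq, h])

instance : Finite A.Region :=
  Finite.of_injective (fun R : A.Region => A.signMap R.point) fun _ _ h => Region.ext_sign h

instance : Finite A.Face := by
  refine Finite.of_injective (fun F : A.Face => F.isFace.choose) fun F G h => Face.ext' ?_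
  have h : F.isFace.choose = G.isFace.choose := h
  rw [F.isFace.choose_spec.2, G.isFace.choose_spec.2, h]

theorem Face.convex (F : A.Face) : Convex ℝ F.carrier := by
  obtain ⟨𝓡, -, h⟩ := F.isFace
  rw [h]
  refine convex_iInter fun R => convex_iInter fun _ => ?_
  rw [R.carrier_eq]
  exact convex_cell _

theorem Face.zero_mem (F : A.Face) : (0 : V) ∈ F.carrier := by
  obtain ⟨𝓡, -, h⟩ := F.isFace
  rw [h]
  refine Set.mem_iInter.2 fun R => Set.mem_iInter.2 fun _ => ?_
  rw [R.carrier_eq]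
  exact zero_mem_cell _

theorem Face.one_sided (F : A.Face) (H : A.hyperplanes) :
    (∀ w ∈ F.carrier, 0 ≤ ⟪A.normal H, w⟫) ∨ (∀ w ∈ F.carrier, ⟪A.normal H, w⟫ ≤ 0) := by
  obtain ⟨𝓡, ⟨R, hR⟩, h⟩ := F.isFace
  have hsub : F.carrier ⊆ A.cell (A.signMap R.point) := by
    rw [h, ← R.carrier_eq]
    exact Set.biInter_subset_of_mem hR
  rcases le_total 0 ⟪A.normal H, R.point⟫ with h' | h'
  · exact Or.inl fun w hw => (mem_cell_signMap.1 (hsub hw) H).1 h'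
  · exact Or.inr fun w hw => (mem_cell_signMap.1 (hsub hw) H).2 h'

/-- A linear form of the arrangement that vanishes at a relative interior point of a face vanishes
on the whole face. -/
theorem Face.eq_zero_of_relint (F : A.Face) {H : A.hyperplanes} {v w : V}
    (hv : v ∈ intrinsicInterior ℝ F.carrier) (h0 : ⟪A.normal H, v⟫ = 0) (hw : w ∈ F.carrier) :
    ⟪A.normal H, w⟫ = 0 := by
  obtain ⟨y, hy, rfl⟩ := mem_intrinsicInterior.1 hv
  have hw' : w ∈ affineSpan ℝ F.carrier := subset_affineSpan ℝ _ hw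
  let l : ℝ → affineSpan ℝ F.carrier := fun t =>
    ⟨AffineMap.lineMap (y : V) w t, AffineMap.lineMap_mem t y.2 hw'⟩
  have hl : Continuous l := by
    refine Continuous.subtype_mk ?_ _
    exact AffineMap.lineMap_continuous
  have hl0 : l 0 = y := Subtype.ext (by simp [l])
  have hev : ∀ᶠ t in nhds (0 : ℝ), l t ∈ interior ((↑) ⁻¹' F.carrier) :=
    hl.continuousAt.eventually (by rw [hl0]; exact isOpen_interior.mem_nhds hy)
  have hneg : ∃ t < (0 : ℝ), ((l t : affineSpan ℝ F.carrier) : V) ∈ F.carrier := by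
    have h1 : ∀ᶠ t in nhdsWithin (0 : ℝ) (Set.Iio 0),
        l t ∈ interior ((↑) ⁻¹' F.carrier) := hev.filter_mono nhdsWithin_le_nhds
    obtain ⟨t, ht, ht'⟩ := (h1.and self_mem_nhdsWithin).exists
    have ht2 : l t ∈ ((↑) ⁻¹' F.carrier : Set (affineSpan ℝ F.carrier)) := interior_subset ht
    exact ⟨t, ht', ht2⟩
  obtain ⟨t, ht, hmem⟩ := hneg
  have hval : ⟪A.normal H, (l t : V)⟫ = t * ⟪A.normal H, w⟫ := by
    change ⟪A.normal H, AffineMap.lineMap (y : V) w t⟫ = _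
    rw [AffineMap.lineMap_apply_module, inner_comb, h0]
    ring
  rcases F.one_sided H with h | h
  · have h1 := h _ hmem
    have h2 := h w hw
    rw [hval] at h1
    nlinarith
  · have h1 := h _ hmem
    have h2 := h w hw
    rw [hval] at h1
    nlinarith

/-- The sign vector is constant on the relative interior of a face. -/
theorem Face.signMap_eq (F : A.Face) {v w : V} (hv : v ∈ intrinsicInterior ℝ F.carrier)
    (hw : w ∈ intrinsicInterior ℝ F.carrier) : A.signMap v = A.signMap w := by
  funext H
  have hv' := intrinsicInterior_subset hv
  have hw' := intrinsicInterior_subset hw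
  simp only [signMap]
  by_cases h0 : ⟪A.normal H, v⟫ = 0
  · rw [h0, F.eq_zero_of_relint hv h0 hw']
  · have h1 : ⟪A.normal H, w⟫ ≠ 0 := fun h => h0 (F.eq_zero_of_relint hw h hv')
    rcases F.one_sided H with h | h
    · rw [sign_pos (lt_of_le_of_ne (h v hv') (Ne.symm h0)),
        sign_pos (lt_of_le_of_ne (h w hw') (Ne.symm h1))]
    · rw [sign_neg (lt_of_le_of_ne (h v hv') h0), sign_neg (lt_of_le_of_ne (h w hw') h1)]

/-- A face lies in a region iff the signs agree wherever the face has a nonzero sign. -/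
theorem Face.subset_region_iff (F : A.Face) {v : V} (hv : v ∈ intrinsicInterior ℝ F.carrier)
    (R : A.Region) : F.carrier ⊆ R.carrier ↔
      ∀ H, A.signMap v H ≠ 0 → A.signMap R.point H = A.signMap v H := by
  have hv' := intrinsicInterior_subset hv
  rw [R.carrier_eq]
  constructor
  · intro h H h0
    have h1 := mem_cell_signMap.1 (h hv') H
    have h2 := mem_complement.1 R.point_mem H
    have h3 : ⟪A.normal H, v⟫ ≠ 0 := fun h => h0 (sign_eq_zero_iff.2 h)
    simp only [signMap]
    rcases lt_or_gt_of_ne h2 with h' | h'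
    · rw [sign_neg h', sign_neg (lt_of_le_of_ne (h1.2 h'.le) h3)]
    · rw [sign_pos h', sign_pos (lt_of_le_of_ne (h1.1 h'.le) h3.symm)]
  · intro h w hw
    rw [mem_cell]
    intro H
    by_cases h0 : ⟪A.normal H, v⟫ = 0
    · simp [F.eq_zero_of_relint hv h0 hw]
    · rw [h H fun h => h0 (sign_eq_zero_iff.1 h)]
      simp only [signMap, sign_nonneg_iff, sign_nonpos_iff]
      rcases F.one_sided H with h' | h'
      · exact ⟨fun _ => h' w hw, fun h1 => absurd (le_antisymm h1 (h' v hv')) h0⟩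
      · exact ⟨fun h1 => absurd (le_antisymm (h' v hv') h1) h0, fun _ => h' w hw⟩

/-- Moving slightly from `v` in the direction of `b` realizes the composition of sign vectors. -/
theorem exists_perturb (v : V) {b : V} (hb : b ∈ A.complement) :
    ∃ x ∈ A.complement, ∀ H,
      A.signMap x H = if A.signMap v H ≠ 0 then A.signMap v H else A.signMap b H := by
  have hev : ∀ H : A.hyperplanes, ∀ᶠ t in nhdsWithin (0 : ℝ) (Set.Ioi 0),
      A.signMap (v + t • b) H =
        if A.signMap v H ≠ 0 then A.signMap v H else A.signMap b H := by
    intro H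
    have hc : Filter.Tendsto (fun t : ℝ => ⟪A.normal H, v + t • b⟫)
        (nhdsWithin 0 (Set.Ioi 0)) (nhds ⟪A.normal H, v⟫) := by
      have : Continuous fun t : ℝ => ⟪A.normal H, v + t • b⟫ := by fun_prop
      simpa using (this.tendsto 0).mono_left nhdsWithin_le_nhds
    rcases lt_trichotomy ⟪A.normal H, v⟫ 0 with h | h | h
    · filter_upwards [hc.eventually (gt_mem_nhds h)] with t ht
      simp [signMap, sign_neg h, sign_neg ht]
    · filter_upwards [self_mem_nhdsWithin] with t ht
      have ht : 0 < t := ht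
      simp [signMap, inner_add_right, inner_smul_right, h, sign_mul, sign_pos ht]
    · filter_upwards [hc.eventually (lt_mem_nhds h)] with t ht
      simp [signMap, sign_pos h, sign_pos ht]
  obtain ⟨t, ht⟩ := (Filter.eventually_all.2 hev).exists
  refine ⟨v + t • b, mem_complement.2 fun H h0 => ?_, ht⟩
  have h1 := ht H
  have h2 : A.signMap (v + t • b) H = 0 := sign_eq_zero_iff.2 h0
  have h3 := signMap_ne_zero hb H
  rw [h2] at h1
  split_ifs at h1 with h
  · exact h h1.symm
  · exact h3 h1.symm

theorem Face.carrier_eq_iInter (F : A.Face) :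
    F.carrier = ⋂ R ∈ {R : A.Region | F.carrier ⊆ R.carrier}, R.carrier := by
  apply Set.Subset.antisymm
  · exact Set.subset_iInter₂ fun R hR => hR
  · obtain ⟨𝓡, -, h⟩ := F.isFace
    intro v hv
    rw [h]
    refine Set.mem_iInter₂.2 fun R hR => Set.mem_iInter₂.1 hv R ?_
    change F.carrier ⊆ R.carrier
    rw [h]
    exact Set.biInter_subset_of_mem hR

end Facts

/-! ### The poset of regions and the facial weak order -/

/-- The set of regions, to be ordered with base region `B`. -/
def PosetOfRegions (A : HyperplaneArrangement V) (_B : A.Region) : Type _ := A.Region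

/-- The poset of regions with base region `B`: `R ≤ R'` iff `S(B, R) ⊆ S(B, R')`. -/
instance (A : HyperplaneArrangement V) (B : A.Region) : PartialOrder (A.PosetOfRegions B) where
  le R R' := A.separationSet B R ⊆ A.separationSet B R'
  le_refl _ := Set.Subset.rfl
  le_trans _ _ _ h h' := Set.Subset.trans h h'
  le_antisymm R R' h h' := by
    refine Region.ext_sign (funext fun H => ?_)
    have h1 := fun x => mem_separationSet.1 (@h H (mem_separationSet.2 x))
    have h2 := fun x => mem_separationSet.1 (@h' H (mem_separationSet.2 x))
    have h3 := signMap_ne_zero (Region.point_mem R) H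
    have h4 := signMap_ne_zero (Region.point_mem R') H
    have h5 := signMap_ne_zero (Region.point_mem B) H
    revert h1 h2 h3 h4 h5
    generalize A.signMap (Region.point R) H = r
    generalize A.signMap (Region.point R') H = r'
    generalize A.signMap (Region.point B) H = b
    revert r r' b
    decide

variable [FiniteDimensional ℝ V]

theorem Face.relint_nonempty {A : HyperplaneArrangement V} (F : A.Face) :
    (intrinsicInterior ℝ F.carrier).Nonempty :=
  Set.Nonempty.intrinsicInterior F.convex ⟨0, F.zero_mem⟩

/-- The covector of a face: its sign vector at any point of its relative interior (the choice of
the point does not matter, see `Face.covector_eq`). -/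
noncomputable def Face.covector {A : HyperplaneArrangement V} (F : A.Face) :
    A.hyperplanes → SignType :=
  A.signMap F.relint_nonempty.some

theorem Face.covector_eq {A : HyperplaneArrangement V} (F : A.Face) {v : V}
    (hv : v ∈ intrinsicInterior ℝ F.carrier) : F.covector = A.signMap v :=
  F.signMap_eq F.relint_nonempty.some_mem hv

/-- The regions containing a face form an interval of the poset of regions. -/
theorem Face.exists_facialInterval {A : HyperplaneArrangement V} (F : A.Face) (B : A.Region) :
    ∃ I : A.PosetOfRegions B × A.PosetOfRegions B, I.1 ≤ I.2 ∧
      {R : A.PosetOfRegions B | F.carrier ⊆ Region.carrier R} = Set.Icc I.1 I.2 := by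
  obtain ⟨v, hv⟩ := F.relint_nonempty
  have hb := B.point_mem
  have hb' : -B.point ∈ A.complement := by
    rw [mem_complement] at *
    intro H
    rw [inner_neg_right]
    exact neg_ne_zero.2 (hb H)
  have hneg : ∀ H, A.signMap (-B.point) H = -A.signMap B.point H := fun H => by
    simp only [signMap, inner_neg_right, Left.sign_neg]
  obtain ⟨x, hx, hxs⟩ := exists_perturb v hb
  obtain ⟨y, hy, hys⟩ := exists_perturb v hb'
  obtain ⟨m, hm⟩ := exists_region hx
  obtain ⟨M, hM⟩ := exists_region hy
  have hmem : ∀ R : A.Region, F.carrier ⊆ R.carrier ↔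
      A.separationSet B m ⊆ A.separationSet B R ∧
        A.separationSet B R ⊆ A.separationSet B M := by
    intro R
    rw [F.subset_region_iff hv]
    simp only [Set.subset_def, ← forall_and, mem_separationSet, hm, hM, hxs, hys, hneg]
    refine forall_congr' fun H => ?_
    have h1 := signMap_ne_zero R.point_mem H
    have h2 := signMap_ne_zero B.point_mem H
    revert h1 h2
    generalize A.signMap R.point H = r
    generalize A.signMap B.point H = b
    generalize A.signMap v H = s
    cases r <;> cases b <;> cases s <;> decide
  refine ⟨⟨m, M⟩, ?_, Set.ext hmem⟩
  have hFm : F.carrier ⊆ m.carrier := by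
    rw [F.subset_region_iff hv]
    intro H h0
    rw [hm, hxs, if_pos h0]
  exact ((hmem m).1 hFm).2

/-- The lower end `m_F` of the facial interval `[m_F, M_F] = {R | F ⊆ R}`. -/
noncomputable def Face.minRegion {A : HyperplaneArrangement V} (F : A.Face) (B : A.Region) :
    A.PosetOfRegions B := (F.exists_facialInterval B).choose.1

/-- The upper end `M_F` of the facial interval `[m_F, M_F] = {R | F ⊆ R}`. -/
noncomputable def Face.maxRegion {A : HyperplaneArrangement V} (F : A.Face) (B : A.Region) :
    A.PosetOfRegions B := (F.exists_facialInterval B).choose.2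

theorem Face.facialInterval_eq {A : HyperplaneArrangement V} (F : A.Face) (B : A.Region) :
    {R : A.PosetOfRegions B | F.carrier ⊆ Region.carrier R} =
      Set.Icc (F.minRegion B) (F.maxRegion B) :=
  (F.exists_facialInterval B).choose_spec.2

/-- The set of faces, to be ordered by the facial weak order with base region `B`. -/
def FacialWeakOrder (A : HyperplaneArrangement V) (_B : A.Region) : Type _ := A.Face

/-- The facial weak order: `F ≤ G` iff `m_F ≤ m_G` and `M_F ≤ M_G` in the poset of regions. -/
instance (A : HyperplaneArrangement V) (B : A.Region) : PartialOrder (A.FacialWeakOrder B) where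
  le F G := Face.minRegion F B ≤ Face.minRegion G B ∧ Face.maxRegion F B ≤ Face.maxRegion G B
  le_refl _ := ⟨le_rfl, le_rfl⟩
  le_trans _ _ _ h h' := ⟨h.1.trans h'.1, h.2.trans h'.2⟩
  le_antisymm F G h h' := by
    have h1 := le_antisymm h.1 h'.1
    have h2 := le_antisymm h.2 h'.2
    have h3 := Face.facialInterval_eq F B
    rw [h1, h2, ← Face.facialInterval_eq G B] at h3
    have h4 : {R : A.Region | Face.carrier F ⊆ R.carrier} =
      {R : A.Region | Face.carrier G ⊆ R.carrier} := h3
    apply Face.ext'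
    rw [Face.carrier_eq_iInter F, Face.carrier_eq_iInter G, h4]

instance (A : HyperplaneArrangement V) (B : A.Region) : Finite (A.FacialWeakOrder B) :=
  inferInstanceAs (Finite A.Face)

open scoped Classical in
/-- The Möbius function of the facial weak order with base region `B`. -/
noncomputable def facialMobius (A : HyperplaneArrangement V) (B : A.Region)
    (X Y : A.FacialWeakOrder B) : ℤ :=
  letI : Fintype (A.FacialWeakOrder B) := Fintype.ofFinite _
  letI : LocallyFiniteOrder (A.FacialWeakOrder B) := Fintype.toLocallyFiniteOrder
  IncidenceAlgebra.mu ℤ X Y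

/-- The dimension of a face: the dimension of its linear span. -/
noncomputable def Face.dim {A : HyperplaneArrangement V} (F : A.Face) : ℕ :=
  Module.finrank ℝ (Submodule.span ℝ F.carrier)

/-- The intersection of two faces, which is again a face. -/
def Face.inter {A : HyperplaneArrangement V} (F G : A.Face) : A.Face where
  carrier := F.carrier ∩ G.carrier
  isFace := by
    obtain ⟨𝓡, h𝓡, hF⟩ := F.isFace
    obtain ⟨𝓢, -, hG⟩ := G.isFace
    exact ⟨𝓡 ∪ 𝓢, h𝓡.inl, by rw [hF, hG, Set.biInter_union]⟩

/-- The reorientation `F_{-G}` of a sign vector `F` by a sign vector `G`: the sign of `F(H)` is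
reversed where `G(H) = 0`, and kept elsewhere. -/
def reorient (A : HyperplaneArrangement V) (F G : A.hyperplanes → SignType) :
    A.hyperplanes → SignType :=
  fun H => if G H = 0 then -F H else F H

end HyperplaneArrangement

/-!
In terms of covectors the facial weak order is the entrywise order, with the sign of the base
region smallest on every hyperplane (`facialWeakOrder_le_iff`). Write `F ∘ G` for the face whose
covector is that of `F` where it is nonzero and that of `G` elsewhere, and let `f X Y` be the
claimed value of `μ(X, Y)`. Since the Möbius function is the left inverse of the zeta function, it
suffices that `∑ f X W` over `W ∈ [X, Y]` vanishes for `X < Y`.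

All signed counts come from the additivity of the Euler characteristic. If the signs on some of the
hyperplanes are prescribed by a point `y`, the faces `Z` with these signs have
`∑ (-1) ^ dim Z = (-1) ^ d`, with `d` the dimension of the corresponding cell of the subarrangement
(`sum_neg_one_pow_dim_fiber`). By inclusion-exclusion, for distinct faces `X`, `Y` with the same
zero set, the faces of `X` lying only on walls that separate `X` from `Y` have signed count zero
(`sum_neg_one_pow_dim_visible`). For `Y = Z ∘ (-X)` this is the Euler relation for the faces of `X`
that contain `Z` (`sum_neg_one_pow_dim_interval`), and the latter gives Weisner's theorem
(`sum_neg_one_pow_dim_inter_eq`).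

To sum `f X W` over `W ∈ [X, Y]`, group the faces `W` by `Z = X ∩ W`. Here `Z` runs through the
faces of `X` in `[X, Y]`, and `W` through the faces of `Z ∘ Y` that meet `X_{-Z} = Z ∘ (-X)` only in
`Z` (`Face.mobiusNeZero_iff`). By Weisner's theorem the group of `Z` contributes `± (-1) ^ dim Z` if
`Z ∘ Y` is a face of `Z ∘ (-X)`, and nothing otherwise. That condition says that `Y` lies in the
linear span of `X`, whatever `Z` is (`Face.comp_subset_comp_neg_iff`). If it holds, the remaining
sum of `(-1) ^ dim Z` vanishes by `sum_neg_one_pow_dim_visible`, applied to `X` and `Y ∘ (-X)`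
(`sum_neg_one_pow_dim_weakLE`).
-/

/-- The Möbius function is the only left inverse of the zeta function. -/
theorem IncidenceAlgebra.mu_eq_of_sum_Icc {P : Type*} [PartialOrder P] [LocallyFiniteOrder P]
    [DecidableEq P] (f : P → P → ℤ) (hself : ∀ x, f x x = 1)
    (hsum : ∀ x y, x < y → ∑ w ∈ Finset.Icc x y, f x w = 0) {x y : P} (hxy : x ≤ y) :
    IncidenceAlgebra.mu ℤ x y = f x y := by
  induction h : (Finset.Icc x y).card using Nat.strong_induction_on generalizing y with
  | _ n ih =>
    rcases hxy.eq_or_lt with rfl | hlt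
    · rw [hself, IncidenceAlgebra.mu_self]
    · have h1 := hsum x y hlt
      have h2 := IncidenceAlgebra.sum_Icc_mu_right (𝕜 := ℤ) x y
      rw [if_neg hlt.ne] at h2
      rw [← Finset.sum_erase_add _ _ (Finset.right_mem_Icc.2 hxy)] at h1 h2
      have h3 : ∑ w ∈ (Finset.Icc x y).erase y, IncidenceAlgebra.mu ℤ x w =
          ∑ w ∈ (Finset.Icc x y).erase y, f x w := by
        refine Finset.sum_congr rfl fun w hw => ?_
        rw [Finset.mem_erase, Finset.mem_Icc] at hw
        refine ih _ ?_ hw.2.1 rfl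
        rw [← h]
        refine Finset.card_lt_card (Finset.ssubset_iff_of_subset
          (Finset.Icc_subset_Icc_right hw.2.2) |>.2 ⟨y, Finset.right_mem_Icc.2 hxy, fun hy => ?_⟩)
        exact hw.1 (le_antisymm hw.2.2 (Finset.mem_Icc.1 hy).2)
      rw [h3] at h2
      linarith

namespace HyperplaneArrangement

variable {V : Type*} [NormedAddCommGroup V] [InnerProductSpace ℝ V] {A : HyperplaneArrangement V}

/-! ### Sign vectors of points -/

theorem signMap_neg (v : V) (H : A.hyperplanes) : A.signMap (-v) H = -A.signMap v H := by
  simp only [signMap, inner_neg_right, Left.sign_neg]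

/-- For small positive `t`, the sign vector of `v + t • w` is the composition of the sign vectors
of `v` and `w`. -/
theorem exists_signMap_comp (v w : V) :
    ∃ x : V, ∀ H, A.signMap x H = if A.signMap v H ≠ 0 then A.signMap v H else A.signMap w H := by
  have hev : ∀ H : A.hyperplanes, ∀ᶠ t in nhdsWithin (0 : ℝ) (Set.Ioi 0),
      A.signMap (v + t • w) H =
        if A.signMap v H ≠ 0 then A.signMap v H else A.signMap w H := by
    intro H
    have hc : Filter.Tendsto (fun t : ℝ => ⟪A.normal H, v + t • w⟫)
        (nhdsWithin 0 (Set.Ioi 0)) (nhds ⟪A.normal H, v⟫) := by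
      have : Continuous fun t : ℝ => ⟪A.normal H, v + t • w⟫ := by fun_prop
      simpa using (this.tendsto 0).mono_left nhdsWithin_le_nhds
    rcases lt_trichotomy ⟪A.normal H, v⟫ 0 with h | h | h
    · filter_upwards [hc.eventually (gt_mem_nhds h)] with t ht
      simp [signMap, sign_neg h, sign_neg ht]
    · filter_upwards [self_mem_nhdsWithin] with t ht
      have ht : 0 < t := ht
      simp [signMap, inner_add_right, inner_smul_right, h, sign_mul, sign_pos ht]
    · filter_upwards [hc.eventually (lt_mem_nhds h)] with t ht
      simp [signMap, sign_pos h, sign_pos ht]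
  obtain ⟨t, ht⟩ := (Filter.eventually_all.2 hev).exists
  exact ⟨v + t • w, ht⟩

/-! ### Inclusions of cells and the poset of regions -/

theorem Face.carrier_inter (F G : A.Face) : (F.inter G).carrier = F.carrier ∩ G.carrier := rfl

theorem Face.subset_antisymm {F G : A.Face} (h : F.carrier ⊆ G.carrier)
    (h' : G.carrier ⊆ F.carrier) : F = G := Face.ext' (Set.Subset.antisymm h h')

theorem mem_cell_iff_sign {σ : A.hyperplanes → SignType} {v : V} :
    v ∈ A.cell σ ↔ ∀ H, A.signMap v H ≠ 0 → σ H = A.signMap v H := by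
  rw [mem_cell]
  refine forall_congr' fun H => ?_
  have h1 : 0 ≤ ⟪A.normal H, v⟫ ↔ 0 ≤ A.signMap v H := sign_nonneg_iff.symm
  have h2 : ⟪A.normal H, v⟫ ≤ 0 ↔ A.signMap v H ≤ 0 := sign_nonpos_iff.symm
  rw [h1, h2]
  generalize A.signMap v H = s
  generalize σ H = t
  revert s t
  decide

theorem posetOfRegions_le_iff {B : A.Region} {R R' : A.PosetOfRegions B} :
    R ≤ R' ↔ ∀ H, A.signMap (Region.point R) H ≠ A.signMap B.point H →
      A.signMap (Region.point R') H ≠ A.signMap B.point H :=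
  forall_congr' fun _ => imp_congr mem_separationSet mem_separationSet

/-! ### Flats and cells of subarrangements -/

/-- The intersection of those hyperplanes outside `T` that contain `y`. -/
def flatOutside (A : HyperplaneArrangement V) (T : Finset A.hyperplanes) (y : V) :
    Submodule ℝ V :=
  ⨅ H : A.hyperplanes, ⨅ _ : H ∉ T ∧ A.signMap y H = 0, (H : Submodule ℝ V)

theorem signMap_eq_zero_iff {v : V} {H : A.hyperplanes} :
    A.signMap v H = 0 ↔ ⟪A.normal H, v⟫ = 0 := sign_eq_zero_iff

theorem mem_flatOutside {T : Finset A.hyperplanes} {y v : V} :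
    v ∈ A.flatOutside T y ↔ ∀ H, H ∉ T → A.signMap y H = 0 → A.signMap v H = 0 := by
  simp only [flatOutside, Submodule.mem_iInf, A.mem_iff, and_imp, signMap_eq_zero_iff]

theorem flatOutside_congr {T : Finset A.hyperplanes} {y z : V}
    (h : ∀ H, H ∉ T → A.signMap y H = A.signMap z H) :
    A.flatOutside T y = A.flatOutside T z := by
  ext v
  simp only [mem_flatOutside]
  exact forall_congr' fun H => forall_congr' fun hH => by rw [h H hH]

theorem flatOutside_of_insert [DecidableEq A.hyperplanes] {T : Finset A.hyperplanes}
    {H₀ : A.hyperplanes} {y : V} (h : A.signMap y H₀ ≠ 0) :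
    A.flatOutside T y = A.flatOutside (insert H₀ T) y := by
  ext v
  simp only [mem_flatOutside, Finset.mem_insert, not_or]
  refine ⟨fun hv H hH => hv H hH.2, fun hv H hH h0 => hv H ⟨?_, hH⟩ h0⟩
  rintro rfl
  exact h h0

theorem flatOutside_eq_inf [DecidableEq A.hyperplanes] {T : Finset A.hyperplanes}
    {H₀ : A.hyperplanes} (hT : H₀ ∉ T) {y : V} (h : A.signMap y H₀ = 0) :
    A.flatOutside T y = A.flatOutside (insert H₀ T) y ⊓ (H₀ : Submodule ℝ V) := by
  ext v
  simp only [mem_flatOutside, Finset.mem_insert, not_or, Submodule.mem_inf, A.mem_iff]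
  rw [← signMap_eq_zero_iff]
  refine ⟨fun hv => ⟨fun H hH => hv H hH.2, hv H₀ hT h⟩, fun hv H hH h0 => ?_⟩
  by_cases hHH : H = H₀
  · exact hHH ▸ hv.2
  · exact hv.1 H ⟨hHH, hH⟩ h0

/-- If `y` lies on `H₀` and some `u` in the flat of `y` does not, then the cell of `y` in the
subarrangement without `H₀` and `T` crosses `H₀`: moving from `y` along multiples of `u` realizes
every sign on `H₀`. -/
theorem exists_signMap_eq_of_zero [DecidableEq A.hyperplanes] {T : Finset A.hyperplanes}
    {H₀ : A.hyperplanes} {y u : V}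
    (hu : u ∈ A.flatOutside (insert H₀ T) y) (hu0 : ⟪A.normal H₀, u⟫ ≠ 0)
    (h0 : A.signMap y H₀ = 0) (s : SignType) :
    ∃ z, (∀ H, H ∉ insert H₀ T → A.signMap z H = A.signMap y H) ∧ A.signMap z H₀ = s := by
  rw [mem_flatOutside] at hu
  obtain ⟨u', hu', hs⟩ : ∃ u' : V, (∀ H, H ∉ insert H₀ T → A.signMap y H = 0 →
      A.signMap u' H = 0) ∧ A.signMap u' H₀ = s := by
    refine ⟨((s : ℝ) * ⟪A.normal H₀, u⟫) • u, fun H hH h => ?_, ?_⟩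
    · have := signMap_eq_zero_iff.1 (hu H hH h)
      rw [signMap_eq_zero_iff, inner_smul_right, this, mul_zero]
    · have h2 : 0 < ⟪A.normal H₀, u⟫ * ⟪A.normal H₀, u⟫ := mul_self_pos.2 hu0
      simp only [signMap, inner_smul_right, mul_assoc]
      rw [sign_mul, sign_pos h2, mul_one]
      cases s <;> simp
  obtain ⟨z, hz⟩ := exists_signMap_comp (A := A) y u'
  refine ⟨z, fun H hH => ?_, by rw [hz, if_neg (not_not.2 h0), hs]⟩
  rw [hz]
  split_ifs with h
  · rfl
  · rw [hu' H hH (not_not.1 h), not_not.1 h]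

/-- Two points on opposite sides of `H₀` with the same signs off `T` can be joined by a segment,
whose intersection with `H₀` has these signs as well. -/
theorem exists_signMap_zero_of_pos_neg {T : Finset A.hyperplanes} {H₀ : A.hyperplanes} {y p n : V}
    (hp : ∀ H, H ∉ T → A.signMap p H = A.signMap y H) (hp0 : A.signMap p H₀ = 1)
    (hn : ∀ H, H ∉ T → A.signMap n H = A.signMap y H) (hn0 : A.signMap n H₀ = -1) :
    ∃ z, (∀ H, H ∉ T → A.signMap z H = A.signMap y H) ∧ A.signMap z H₀ = 0 := by
  have ha : 0 < ⟪A.normal H₀, p⟫ := sign_eq_one_iff.1 hp0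
  have hb : ⟪A.normal H₀, n⟫ < 0 := sign_eq_neg_one_iff.1 hn0
  refine ⟨(-⟪A.normal H₀, n⟫) • p + ⟪A.normal H₀, p⟫ • n, fun H hH => ?_, ?_⟩
  · have h1 := hp H hH
    have h2 := hn H hH
    rw [← h1] at h2 ⊢
    simp only [signMap] at h2 ⊢
    rw [inner_comb]
    rcases lt_trichotomy ⟪A.normal H, p⟫ 0 with h | h | h
    · rw [sign_neg h, sign_eq_neg_one_iff] at h2
      rw [sign_neg h, sign_eq_neg_one_iff]
      nlinarith
    · rw [h, sign_zero, sign_eq_zero_iff] at h2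
      simp [h, h2]
    · rw [sign_pos h, sign_eq_one_iff] at h2
      rw [sign_pos h, sign_eq_one_iff]
      nlinarith
  · rw [signMap_eq_zero_iff, inner_comb]
    ring

variable [FiniteDimensional ℝ V]

/-! ### Faces and their covectors -/

theorem Face.exists_point (F : A.Face) :
    ∃ v ∈ intrinsicInterior ℝ F.carrier, F.covector = A.signMap v :=
  ⟨_, F.relint_nonempty.some_mem, rfl⟩

theorem Face.carrier_eq_cell (F : A.Face) : F.carrier = A.cell F.covector := by
  obtain ⟨v, hv, hF⟩ := F.exists_point
  apply Set.Subset.antisymm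
  · intro w hw
    rw [hF, mem_cell_signMap]
    intro H
    have hvF := intrinsicInterior_subset hv
    rcases F.one_sided H with h | h
    · exact ⟨fun _ => h w hw, fun h0 => (F.eq_zero_of_relint hv (le_antisymm h0 (h v hvF)) hw).le⟩
    · exact ⟨fun h0 => (F.eq_zero_of_relint hv (le_antisymm (h v hvF) h0) hw).ge, fun _ => h w hw⟩
  · intro w hw
    rw [F.carrier_eq_iInter]
    refine Set.mem_iInter₂.2 fun R hR => ?_
    have h1 := (F.subset_region_iff hv R).1 hR
    rw [hF, mem_cell_iff_sign] at hw
    rw [R.carrier_eq, mem_cell_iff_sign]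
    intro H h0
    rw [h1 H (hw H h0 ▸ h0), hw H h0]

/-- Inclusion of faces is the usual order of covectors: the smaller covector is obtained from the
larger one by replacing some entries by `0`. -/
theorem Face.subset_iff {F G : A.Face} :
    F.carrier ⊆ G.carrier ↔ ∀ H, F.covector H ≠ 0 → G.covector H = F.covector H := by
  constructor
  · intro h
    obtain ⟨v, hv, hF⟩ := F.exists_point
    have h1 := h (intrinsicInterior_subset hv)
    rw [G.carrier_eq_cell, mem_cell_iff_sign] at h1
    rwa [hF]
  · intro h w hw
    rw [carrier_eq_cell, mem_cell_iff_sign] at hw ⊢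
    intro H h0
    rw [h H (hw H h0 ▸ h0), hw H h0]

theorem Face.covector_injective : Function.Injective (Face.covector (A := A)) := fun F G h =>
  Face.ext' (by rw [F.carrier_eq_cell, G.carrier_eq_cell, h])

/-- Every sign vector of a point is the covector of a face, namely of the intersection of the two
regions reached from the point in the directions of `B` and of `-B`. -/
theorem exists_face_covector (B : A.Region) (v : V) : ∃ F : A.Face, F.covector = A.signMap v := by
  have hb := B.point_mem
  have hb' : -B.point ∈ A.complement := by
    rw [mem_complement] at *
    intro H
    rw [inner_neg_right]
    exact neg_ne_zero.2 (hb H)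
  obtain ⟨x, hx, hxs⟩ := exists_perturb v hb
  obtain ⟨y, hy, hys⟩ := exists_perturb v hb'
  obtain ⟨R, hR⟩ := exists_region hx
  obtain ⟨R', hR'⟩ := exists_region hy
  let F : A.Face := ⟨R.carrier ∩ R'.carrier, {R, R'}, ⟨R, by simp⟩, by simp⟩
  have hF : F.carrier = A.cell (A.signMap v) := by
    change R.carrier ∩ R'.carrier = _
    ext w
    rw [Set.mem_inter_iff, R.carrier_eq, R'.carrier_eq, hR, hR', mem_cell_iff_sign,
      mem_cell_iff_sign, mem_cell_iff_sign, ← forall_and]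
    refine forall_congr' fun H => ?_
    rw [hxs, hys, signMap_neg]
    have h := signMap_ne_zero hb H
    revert h
    generalize A.signMap v H = s
    generalize A.signMap w H = t
    generalize A.signMap B.point H = b
    revert s t b
    decide
  refine ⟨F, ?_⟩
  obtain ⟨u, hu, hFu⟩ := F.exists_point
  have h1 : u ∈ F.carrier := intrinsicInterior_subset hu
  have h2 : v ∈ F.carrier := hF ▸ mem_cell_self v
  rw [hF, mem_cell_iff_sign] at h1
  rw [F.carrier_eq_cell, mem_cell_iff_sign, hFu] at h2
  rw [hFu]
  funext H
  have h1 := h1 H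
  have h2 := h2 H
  by_cases h : A.signMap u H = 0
  · by_contra h'
    exact h' (h2 fun h0 => h' (h.trans h0.symm))
  · exact (h1 h).symm

/-- The composition `F ∘ G` of two faces: on a hyperplane where `F` vanishes it has the sign of
`G`, elsewhere that of `F`. -/
theorem Face.exists_comp (B : A.Region) (F G : A.Face) : ∃ K : A.Face,
    ∀ H, K.covector H = if F.covector H ≠ 0 then F.covector H else G.covector H := by
  obtain ⟨v, -, hv⟩ := F.exists_point
  obtain ⟨w, -, hw⟩ := G.exists_point
  obtain ⟨x, hx⟩ := exists_signMap_comp (A := A) v w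
  obtain ⟨K, hK⟩ := exists_face_covector B x
  exact ⟨K, fun H => by rw [hK, hv, hw, hx]⟩

theorem Face.exists_comp_neg (B : A.Region) (F G : A.Face) : ∃ K : A.Face,
    ∀ H, K.covector H = if F.covector H ≠ 0 then F.covector H else -G.covector H := by
  obtain ⟨w, -, hw⟩ := G.exists_point
  obtain ⟨G', hG'⟩ := exists_face_covector B (-w)
  obtain ⟨K, hK⟩ := F.exists_comp B G'
  exact ⟨K, fun H => by rw [hK, hG', hw, signMap_neg]⟩

/-! ### The facial weak order in terms of covectors -/

theorem Face.subset_region_iff_covector (F : A.Face) (R : A.Region) :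
    F.carrier ⊆ R.carrier ↔
      ∀ H, F.covector H ≠ 0 → A.signMap R.point H = F.covector H := by
  obtain ⟨v, hv, hF⟩ := F.exists_point
  rw [hF]
  exact F.subset_region_iff hv R

theorem Face.signMap_minRegion (F : A.Face) (B : A.Region) (H : A.hyperplanes) :
    A.signMap (Region.point (F.minRegion B)) H =
      if F.covector H ≠ 0 then F.covector H else A.signMap B.point H := by
  obtain ⟨v, -, hF⟩ := F.exists_point
  obtain ⟨x, hx, hxs⟩ := exists_perturb v B.point_mem
  obtain ⟨R, hR⟩ := exists_region hx
  have hI := F.facialInterval_eq B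
  have hle : F.minRegion B ≤ F.maxRegion B :=
    (F.exists_facialInterval B).choose_spec.1
  have h1 : F.carrier ⊆ Region.carrier (F.minRegion B) := by
    have : F.minRegion B ∈ {R : A.PosetOfRegions B | F.carrier ⊆ Region.carrier R} := by
      rw [hI]; exact ⟨le_rfl, hle⟩
    exact this
  have h2 : (R : A.PosetOfRegions B) ∈
      {R : A.PosetOfRegions B | F.carrier ⊆ Region.carrier R} := by
    refine (F.subset_region_iff_covector R).2 fun H h0 => ?_
    rw [hR, hxs, ← hF, if_pos h0]
  rw [hI] at h2
  have h3 : A.separationSet B (F.minRegion B) ⊆ A.separationSet B R := h2.1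
  split_ifs with h0
  · exact (F.subset_region_iff_covector _).1 h1 H h0
  · by_contra h
    refine mem_separationSet.1 (h3 (mem_separationSet.2 h)) ?_
    rw [hR, hxs, ← hF, if_neg h0]

theorem Face.signMap_maxRegion (F : A.Face) (B : A.Region) (H : A.hyperplanes) :
    A.signMap (Region.point (F.maxRegion B)) H =
      if F.covector H ≠ 0 then F.covector H else -A.signMap B.point H := by
  obtain ⟨v, -, hF⟩ := F.exists_point
  have hb' : -B.point ∈ A.complement := by
    have hb := B.point_mem
    rw [mem_complement] at *
    intro H
    rw [inner_neg_right]
    exact neg_ne_zero.2 (hb H)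
  obtain ⟨x, hx, hxs⟩ := exists_perturb v hb'
  obtain ⟨R, hR⟩ := exists_region hx
  have hI := F.facialInterval_eq B
  have hle : F.minRegion B ≤ F.maxRegion B :=
    (F.exists_facialInterval B).choose_spec.1
  have h1 : F.carrier ⊆ Region.carrier (F.maxRegion B) := by
    have : F.maxRegion B ∈ {R : A.PosetOfRegions B | F.carrier ⊆ Region.carrier R} := by
      rw [hI]; exact ⟨hle, le_rfl⟩
    exact this
  have h2 : (R : A.PosetOfRegions B) ∈
      {R : A.PosetOfRegions B | F.carrier ⊆ Region.carrier R} := by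
    refine (F.subset_region_iff_covector R).2 fun H h0 => ?_
    rw [hR, hxs, ← hF, if_pos h0]
  rw [hI] at h2
  have h3 : A.separationSet B R ⊆ A.separationSet B (F.maxRegion B) := h2.2
  split_ifs with h0
  · exact (F.subset_region_iff_covector _).1 h1 H h0
  · have h4 : A.signMap R.point H = -A.signMap B.point H := by
      rw [hR, hxs, ← hF, if_neg h0, signMap_neg]
    have h5 := signMap_ne_zero B.point_mem H
    have h6 := signMap_ne_zero (Region.point_mem (F.maxRegion B)) H
    have h7 : A.signMap (Region.point (F.maxRegion B)) H ≠ A.signMap B.point H := by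
      refine mem_separationSet.1 (h3 (mem_separationSet.2 ?_))
      rw [h4]
      revert h5
      generalize A.signMap B.point H = b
      revert b
      decide
    revert h5 h6 h7
    generalize A.signMap B.point H = b
    generalize A.signMap (Region.point (F.maxRegion B)) H = c
    revert b c
    decide

theorem Face.region_le_iff {B : A.Region} {F G : A.Face} :
    F.minRegion B ≤ G.minRegion B ∧ F.maxRegion B ≤ G.maxRegion B ↔
      ∀ H, A.signMap B.point H * G.covector H ≤ A.signMap B.point H * F.covector H := by
  simp only [posetOfRegions_le_iff, ← forall_and, Face.signMap_minRegion, Face.signMap_maxRegion]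
  refine forall_congr' fun H => ?_
  have h := signMap_ne_zero B.point_mem H
  revert h
  generalize A.signMap B.point H = b
  generalize F.covector H = x
  generalize G.covector H = y
  revert b x y
  decide

/-- The facial weak order compares covectors entrywise, the sign of the base region being the
smallest one on every hyperplane. -/
theorem facialWeakOrder_le_iff {B : A.Region} {F G : A.FacialWeakOrder B} :
    F ≤ G ↔ ∀ H, A.signMap B.point H * Face.covector G H ≤
      A.signMap B.point H * Face.covector F H :=
  Face.region_le_iff

/-! ### Signed counts of faces -/

theorem finrank_inf_hyperplane (U : Submodule ℝ V) (H : A.hyperplanes) {u : V} (hu : u ∈ U)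
    (hH : ⟪A.normal H, u⟫ ≠ 0) :
    Module.finrank ℝ (U ⊓ (H : Submodule ℝ V) : Submodule ℝ V) + 1 = Module.finrank ℝ U := by
  let f : U →ₗ[ℝ] ℝ := (innerₛₗ ℝ (A.normal H)).domRestrict U
  have hf : ∀ x : U, f x = ⟪A.normal H, (x : V)⟫ := fun x => rfl
  have h1 : Function.Surjective f :=
    LinearMap.surjective fun h => hH (by rw [← hf ⟨u, hu⟩, h]; rfl)
  have h2 := f.finrank_range_add_finrank_ker
  rw [LinearMap.range_eq_top.2 h1, finrank_top, Module.finrank_self] at h2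
  have h3 : (LinearMap.ker f).map U.subtype = U ⊓ (H : Submodule ℝ V) := by
    ext x
    simp only [Submodule.mem_map, LinearMap.mem_ker, hf, Submodule.subtype_apply,
      Submodule.mem_inf, A.mem_iff]
    exact ⟨by rintro ⟨y, hy, rfl⟩; exact ⟨y.2, hy⟩, fun h => ⟨⟨x, h.1⟩, h.2, rfl⟩⟩
  rw [← h3, (Submodule.equivMapOfInjective U.subtype U.injective_subtype
    (LinearMap.ker f)).symm.finrank_eq]
  omega

/-- The linear span of a face is the intersection of the hyperplanes containing it. -/
theorem Face.dim_eq (F : A.Face) {y : V} (h : F.covector = A.signMap y) :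
    F.dim = Module.finrank ℝ (A.flatOutside ∅ y) := by
  have hspan : Submodule.span ℝ F.carrier = A.flatOutside ∅ y := by
    rw [F.carrier_eq_cell, h]
    apply le_antisymm
    · refine Submodule.span_le.2 fun v hv => ?_
      rw [mem_cell_iff_sign] at hv
      refine mem_flatOutside.2 fun H _ h0 => ?_
      by_contra h'
      exact h' ((hv H h').symm.trans h0)
    · intro v hv
      rw [mem_flatOutside] at hv
      obtain ⟨t, ht0, ht⟩ : ∃ t : ℝ, 0 < t ∧ ∀ H, A.signMap (y + t • v) H = A.signMap y H := by
        have hev : ∀ H : A.hyperplanes, ∀ᶠ t in nhdsWithin (0 : ℝ) (Set.Ioi 0),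
            A.signMap (y + t • v) H = A.signMap y H := by
          intro H
          have hc : Filter.Tendsto (fun t : ℝ => ⟪A.normal H, y + t • v⟫)
              (nhdsWithin 0 (Set.Ioi 0)) (nhds ⟪A.normal H, y⟫) := by
            have : Continuous fun t : ℝ => ⟪A.normal H, y + t • v⟫ := by fun_prop
            simpa using (this.tendsto 0).mono_left nhdsWithin_le_nhds
          rcases lt_trichotomy ⟪A.normal H, y⟫ 0 with h | h | h
          · filter_upwards [hc.eventually (gt_mem_nhds h)] with t ht
            simp [signMap, sign_neg h, sign_neg ht]
          · have h2 := signMap_eq_zero_iff.1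
              (hv H (Finset.notMem_empty H) (signMap_eq_zero_iff.2 h))
            exact Filter.Eventually.of_forall fun t => by
              simp [signMap, inner_add_right, inner_smul_right, h, h2]
          · filter_upwards [hc.eventually (lt_mem_nhds h)] with t ht
            simp [signMap, sign_pos h, sign_pos ht]
        obtain ⟨t, ht, ht0⟩ := ((Filter.eventually_all.2 hev).and self_mem_nhdsWithin).exists
        exact ⟨t, ht0, ht⟩
      have h1 : y + t • v ∈ Submodule.span ℝ (A.cell (A.signMap y)) :=
        Submodule.subset_span (by
          have := mem_cell_self (A := A) (y + t • v)
          rwa [funext ht] at this)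
      have h2 : y ∈ Submodule.span ℝ (A.cell (A.signMap y)) :=
        Submodule.subset_span (mem_cell_self y)
      have h3 := Submodule.sub_mem _ h1 h2
      rw [add_sub_cancel_left] at h3
      exact (Submodule.smul_mem_iff _ ht0.ne').1 h3
  rw [Face.dim, hspan]

noncomputable instance : Fintype A.Face := Fintype.ofFinite _

open scoped Classical in
/-- The Euler characteristic of a relatively open cell of a subarrangement, computed from the faces
of the whole arrangement that it contains. Adding one hyperplane to the subarrangement leaves a
cell of dimension `d` as it is or cuts it into pieces of dimensions `d`, `d - 1` and `d`. -/
theorem sum_neg_one_pow_dim_fiber (B : A.Region) (T : Finset A.hyperplanes) (y : V) :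
    ∑ Z : A.Face with ∀ H, H ∉ T → Z.covector H = A.signMap y H, (-1 : ℤ) ^ Z.dim =
      (-1) ^ Module.finrank ℝ (A.flatOutside T y) := by
  induction T using Finset.induction_on generalizing y with
  | empty =>
    obtain ⟨F, hF⟩ := exists_face_covector B y
    have : Finset.univ.filter (fun Z : A.Face => ∀ H, H ∉ (∅ : Finset A.hyperplanes) →
        Z.covector H = A.signMap y H) = {F} := by
      ext Z
      simp only [Finset.mem_filter, Finset.mem_univ, true_and, Finset.notMem_empty,
        not_false_eq_true, true_imp_iff, Finset.mem_singleton]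
      rw [← funext_iff, ← hF]
      exact Face.covector_injective.eq_iff
    rw [this, Finset.sum_singleton, F.dim_eq hF]
  | insert H₀ T hH₀ ih =>
    set U := A.flatOutside (insert H₀ T) y with hU
    let N : SignType → ℤ := fun s =>
      ∑ Z : A.Face with (∀ H, H ∉ insert H₀ T → Z.covector H = A.signMap y H) ∧
        Z.covector H₀ = s, (-1 : ℤ) ^ Z.dim
    have hsplit : ∑ Z : A.Face with ∀ H, H ∉ insert H₀ T → Z.covector H = A.signMap y H,
        (-1 : ℤ) ^ Z.dim = N 0 + N (-1) + N 1 := by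
      rw [← Finset.sum_fiberwise (g := fun Z : A.Face => Z.covector H₀)]
      simp only [Finset.filter_filter]
      change ∑ s : SignType, N s = _
      have : (Finset.univ : Finset SignType) = {0, -1, 1} := by decide
      rw [this, Finset.sum_insert (by decide), Finset.sum_insert (by decide),
        Finset.sum_singleton, add_assoc]
    have hN : ∀ z : V, (∀ H, H ∉ insert H₀ T → A.signMap z H = A.signMap y H) →
        N (A.signMap z H₀) = (-1) ^ Module.finrank ℝ (A.flatOutside T z) := by
      intro z hz
      rw [← ih z]
      refine Finset.sum_congr (Finset.filter_congr fun Z _ => ?_) fun _ _ => rfl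
      constructor
      · rintro ⟨h1, h2⟩ H hH
        by_cases h : H = H₀
        · rw [h, h2]
        · rw [h1 H (by simp [h, hH]), hz H (by simp [h, hH])]
      · intro h
        refine ⟨fun H hH => ?_, h H₀ hH₀⟩
        rw [h H fun h' => hH (Finset.mem_insert_of_mem h'), hz H hH]
    have hN0 : ∀ s, (∀ z : V, (∀ H, H ∉ insert H₀ T → A.signMap z H = A.signMap y H) →
        A.signMap z H₀ ≠ s) → N s = 0 := by
      intro s hs
      refine Finset.sum_eq_zero fun Z hZ => ?_
      obtain ⟨v, -, hv⟩ := Z.exists_point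
      rw [Finset.mem_filter, hv] at hZ
      exact absurd hZ.2.2 (hs v hZ.2.1)
    have hne : ∀ z : V, (∀ H, H ∉ insert H₀ T → A.signMap z H = A.signMap y H) →
        A.signMap z H₀ ≠ 0 → N (A.signMap z H₀) = (-1) ^ Module.finrank ℝ U := by
      intro z hz h0
      rw [hN z hz, flatOutside_of_insert h0, flatOutside_congr hz]
    rw [hsplit]
    by_cases hle : ∀ u ∈ U, ⟪A.normal H₀, u⟫ = 0
    · -- The points of the fibre lie in `U`, hence in `H₀`.
      have hz0 : ∀ z : V, (∀ H, H ∉ insert H₀ T → A.signMap z H = A.signMap y H) →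
          A.signMap z H₀ = 0 := fun z hz =>
        signMap_eq_zero_iff.2 (hle z (mem_flatOutside.2 fun H hH h0 => (hz H hH).trans h0))
      have hy0 := hz0 y fun _ _ => rfl
      have hy := hN y fun _ _ => rfl
      rw [hy0, flatOutside_eq_inf hH₀ hy0, ← hU,
        inf_eq_left.2 fun u hu => (A.mem_iff _ _).2 (hle u hu)] at hy
      rw [hy, hN0 (-1) fun z hz h => absurd ((hz0 z hz).symm.trans h) (by decide),
        hN0 1 fun z hz h => absurd ((hz0 z hz).symm.trans h) (by decide), add_zero, add_zero]
    · push Not at hle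
      obtain ⟨u, hu, hu0⟩ := hle
      by_cases hz : ∃ z, (∀ H, H ∉ insert H₀ T → A.signMap z H = A.signMap y H) ∧
          A.signMap z H₀ = 0
      · obtain ⟨z, hz, hz0⟩ := hz
        have huz : u ∈ A.flatOutside (insert H₀ T) z := flatOutside_congr hz ▸ hu
        obtain ⟨p, hp, hp0⟩ := exists_signMap_eq_of_zero huz hu0 hz0 1
        obtain ⟨n, hn, hn0⟩ := exists_signMap_eq_of_zero huz hu0 hz0 (-1)
        have h1 := hN z hz
        have h2 := hne p (fun H hH => (hp H hH).trans (hz H hH)) (by rw [hp0]; decide)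
        have h3 := hne n (fun H hH => (hn H hH).trans (hz H hH)) (by rw [hn0]; decide)
        have h4 := finrank_inf_hyperplane U H₀ hu hu0
        rw [hz0, flatOutside_eq_inf hH₀ hz0, flatOutside_congr hz, ← hU] at h1
        rw [hp0] at h2
        rw [hn0] at h3
        rw [h1, h2, h3, ← h4, pow_succ]
        ring
      · -- The fibre misses `H₀`, so by convexity it lies on the side of `y`.
        rw [hN0 0 fun z hz' h0 => hz ⟨z, hz', h0⟩]
        have hy0 : A.signMap y H₀ ≠ 0 := fun h => hz ⟨y, fun _ _ => rfl, h⟩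
        have hy := hne y (fun _ _ => rfl) hy0
        have hcases : A.signMap y H₀ = 1 ∨ A.signMap y H₀ = -1 := by
          revert hy0
          generalize A.signMap y H₀ = s
          revert s
          decide
        rcases hcases with h | h
        · rw [h] at hy
          rw [hy, hN0 (-1) fun z hz' h' =>
            hz (exists_signMap_zero_of_pos_neg (fun _ _ => rfl) h hz' h'), add_zero, zero_add]
        · rw [h] at hy
          rw [hy, hN0 1 fun z hz' h' =>
            hz (exists_signMap_zero_of_pos_neg hz' h' (fun _ _ => rfl) h), add_zero, zero_add]

/-- The entrywise form of the condition in `sum_neg_one_pow_dim_visible`. -/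
theorem sign_visible_iff (x y z : SignType) (h : x = 0 ↔ y = 0) (h' : x = y → z = y) :
    ((z ≠ 0 → x = z) ∧ (x = y → z = x)) ↔ (x ≠ y → z ≠ y) := by
  revert h h'
  cases x <;> cases y <;> cases z <;> decide

open scoped Classical in
/-- For two distinct faces `X` and `Y` in general position in the same flat, the faces of `X` that
avoid all walls not separating `X` from `Y` have vanishing signed count. Inclusion-exclusion over
the separating hyperplanes `H`, using `[Z H ∈ {0, X H}] = 1 - [Z H = Y H]`, turns the count into an
alternating sum of counts of fibres over `Y`, which all have the same value. -/
theorem sum_neg_one_pow_dim_visible (B : A.Region) {X Y : A.Face}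
    (h0 : ∀ H, X.covector H = 0 ↔ Y.covector H = 0) (hXY : X ≠ Y) :
    ∑ Z : A.Face with Z.carrier ⊆ X.carrier ∧
      ∀ H, X.covector H = Y.covector H → Z.covector H = X.covector H, (-1 : ℤ) ^ Z.dim = 0 := by
  obtain ⟨y, -, hy⟩ := Y.exists_point
  set K : Finset A.hyperplanes := Finset.univ.filter fun H => X.covector H ≠ Y.covector H with hK
  have hKne : K.Nonempty := by
    by_contra h
    rw [Finset.not_nonempty_iff_eq_empty, Finset.filter_eq_empty_iff] at h
    exact hXY (Face.covector_injective (funext fun H => not_not.1 (h (Finset.mem_univ H))))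
  have hpt : ∀ Z : A.Face, (if Z.carrier ⊆ X.carrier ∧
      ∀ H, X.covector H = Y.covector H → Z.covector H = X.covector H then (-1 : ℤ) ^ Z.dim else 0) =
      ∑ T ∈ K.powerset, (-1) ^ T.card *
        (if ∀ H, H ∉ K \ T → Z.covector H = A.signMap y H then (-1 : ℤ) ^ Z.dim else 0) := by
    intro Z
    by_cases hZ : ∀ H, H ∉ K → Z.covector H = Y.covector H
    · have h1 : (Z.carrier ⊆ X.carrier ∧
          ∀ H, X.covector H = Y.covector H → Z.covector H = X.covector H) ↔
          ∀ H ∈ K, Z.covector H ≠ Y.covector H := by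
        rw [Face.subset_iff, ← forall_and]
        refine forall_congr' fun H => ?_
        have h2 := h0 H
        have h3 := hZ H
        simp only [hK, Finset.mem_filter, Finset.mem_univ, true_and, not_not] at h3 ⊢
        exact sign_visible_iff _ _ _ h2 h3
      have h2 : ∀ T ∈ K.powerset, (-1 : ℤ) ^ T.card *
          (if ∀ H, H ∉ K \ T → Z.covector H = A.signMap y H then (-1 : ℤ) ^ Z.dim else 0) =
          (∏ H ∈ T, -(if Z.covector H = Y.covector H then (1 : ℤ) else 0)) * (-1) ^ Z.dim := by
        intro T hT
        have h3 : (∀ H, H ∉ K \ T → Z.covector H = A.signMap y H) ↔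
            ∀ H ∈ T, Z.covector H = Y.covector H := by
          rw [← hy]
          constructor
          · intro h H hH
            exact h H (by simp [hH])
          · intro h H hH
            rw [Finset.mem_sdiff, not_and_not_right] at hH
            by_cases hHK : H ∈ K
            · exact h H (hH hHK)
            · exact hZ H hHK
        rw [Finset.prod_neg, Finset.prod_ite_zero, Finset.prod_const_one, if_congr h3 rfl rfl]
        split_ifs <;> simp
      rw [Finset.sum_congr rfl h2, ← Finset.sum_mul, if_congr h1 rfl rfl]
      have h4 := Finset.prod_one_add (s := K)
        (f := fun H => -(if Z.covector H = Y.covector H then (1 : ℤ) else 0))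
      rw [← h4]
      have h5 : ∀ H, (1 : ℤ) + -(if Z.covector H = Y.covector H then (1 : ℤ) else 0) =
          if Z.covector H ≠ Y.covector H then 1 else 0 := by
        intro H
        split_ifs <;> simp_all
      simp only [h5]
      rw [Finset.prod_ite_zero, Finset.prod_const_one]
      split_ifs <;> simp
    · rw [if_neg, Finset.sum_eq_zero]
      · intro T _
        rw [if_neg, mul_zero]
        intro h
        exact hZ fun H hH => hy ▸ h H fun h' => hH (Finset.mem_sdiff.1 h').1
      · rintro ⟨-, h⟩
        refine hZ fun H hH => ?_
        have h2 : X.covector H = Y.covector H := by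
          by_contra h2
          exact hH (by simp [hK, h2])
        rw [h H h2, h2]
  rw [Finset.sum_filter, Finset.sum_congr rfl fun Z _ => hpt Z, Finset.sum_comm]
  have hT : ∀ T ∈ K.powerset, ∑ Z : A.Face, (-1 : ℤ) ^ T.card *
      (if ∀ H, H ∉ K \ T → Z.covector H = A.signMap y H then (-1 : ℤ) ^ Z.dim else 0) =
      (-1) ^ T.card * (-1) ^ Y.dim := by
    intro T _
    have hflat : A.flatOutside (K \ T) y = A.flatOutside ∅ y := by
      ext v
      simp only [mem_flatOutside]
      refine forall_congr' fun H => ⟨fun h _ h1 => h ?_ h1, fun h _ h1 => h (by simp) h1⟩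
      rw [← hy] at h1
      simp [hK, h1, (h0 H).2 h1]
    rw [← Finset.mul_sum, ← Finset.sum_filter, sum_neg_one_pow_dim_fiber B, Y.dim_eq hy, hflat]
  rw [Finset.sum_congr rfl hT, ← Finset.sum_mul,
    Finset.sum_powerset_neg_one_pow_card_of_nonempty hKne, zero_mul]

open scoped Classical in
/-- The interval between two distinct faces in the face lattice of a cone is Eulerian: the faces of
`P` containing `Z` are those that avoid the walls not separating `P` from `Z ∘ (-P)`. -/
theorem sum_neg_one_pow_dim_interval (B : A.Region) {Z P : A.Face}
    (h : Z.carrier ⊆ P.carrier) :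
    ∑ U : A.Face with Z.carrier ⊆ U.carrier ∧ U.carrier ⊆ P.carrier, (-1 : ℤ) ^ U.dim =
      if Z = P then (-1) ^ Z.dim else 0 := by
  split_ifs with hZP
  · subst hZP
    rw [Finset.sum_eq_single Z]
    · intro U hU hne
      rw [Finset.mem_filter] at hU
      exact absurd (Face.subset_antisymm hU.2.2 hU.2.1) hne
    · intro h'
      exact absurd (Finset.mem_filter.2 ⟨Finset.mem_univ _, h, h⟩) h'
  · obtain ⟨Y, hY⟩ := Z.exists_comp_neg B P
    rw [Face.subset_iff] at h
    rw [← sum_neg_one_pow_dim_visible B (X := P) (Y := Y)]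
    · refine Finset.sum_congr (Finset.filter_congr fun U _ => ?_) fun _ _ => rfl
      rw [Face.subset_iff, Face.subset_iff, ← forall_and, ← forall_and]
      refine forall_congr' fun H => ?_
      have h1 := h H
      rw [hY]
      revert h1
      generalize Z.covector H = z
      generalize P.covector H = p
      generalize U.covector H = u
      revert z p u
      decide
    · intro H
      have h1 := h H
      rw [hY]
      revert h1
      generalize Z.covector H = z
      generalize P.covector H = p
      revert z p
      decide
    · rintro rfl
      refine hZP (Face.covector_injective (funext fun H => ?_))
      have h1 := h H
      have h2 := hY H
      revert h1 h2
      generalize Z.covector H = z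
      generalize P.covector H = p
      revert z p
      decide

open scoped Classical in
/-- Weisner's theorem for the face lattice of a cone: the signed count of the faces `W` of `C`
containing `Z` and meeting a given face `X` only in `Z`. -/
theorem sum_neg_one_pow_dim_inter_eq (B : A.Region) {Z C X : A.Face}
    (hC : Z.carrier ⊆ C.carrier) (hX : Z.carrier ⊆ X.carrier) :
    ∑ W : A.Face with Z.carrier ⊆ W.carrier ∧ W.carrier ⊆ C.carrier ∧ W.inter X = Z,
      (-1 : ℤ) ^ W.dim = if C.carrier ⊆ X.carrier then (-1) ^ Z.dim else 0 := by
  have hsq : ∀ n : ℕ, (-1 : ℤ) ^ n * (-1) ^ n = 1 := fun n => by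
    rw [← mul_pow, neg_one_mul, neg_neg, one_pow]
  -- Detect `W ∩ X = Z` by the signed count of the faces between `Z` and `W ∩ X`.
  have h1 : ∀ W : A.Face, (if Z.carrier ⊆ W.carrier ∧ W.carrier ⊆ C.carrier ∧ W.inter X = Z
      then (-1 : ℤ) ^ W.dim else 0) = ∑ U : A.Face with Z.carrier ⊆ U.carrier ∧
        U.carrier ⊆ X.carrier, (-1 : ℤ) ^ Z.dim * (-1) ^ U.dim *
          if U.carrier ⊆ W.carrier ∧ W.carrier ⊆ C.carrier then (-1) ^ W.dim else 0 := by
    intro W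
    by_cases hW : Z.carrier ⊆ W.carrier ∧ W.carrier ⊆ C.carrier
    · have h2 := sum_neg_one_pow_dim_interval B (Z := Z) (P := W.inter X)
        (Set.subset_inter hW.1 hX)
      have h3 : ∑ U : A.Face with Z.carrier ⊆ U.carrier ∧ U.carrier ⊆ X.carrier,
          (-1 : ℤ) ^ Z.dim * (-1) ^ U.dim *
            (if U.carrier ⊆ W.carrier ∧ W.carrier ⊆ C.carrier then (-1) ^ W.dim else 0) =
          (-1) ^ Z.dim * (∑ U : A.Face with Z.carrier ⊆ U.carrier ∧
            U.carrier ⊆ (W.inter X).carrier, (-1) ^ U.dim) * (-1) ^ W.dim := by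
        rw [Finset.mul_sum, Finset.sum_mul, Finset.sum_filter, Finset.sum_filter]
        refine Finset.sum_congr rfl fun U _ => ?_
        rw [Face.carrier_inter, Set.subset_inter_iff]
        by_cases a : Z.carrier ⊆ U.carrier <;> by_cases b : U.carrier ⊆ X.carrier <;>
          by_cases c : U.carrier ⊆ W.carrier <;> simp [a, b, c, hW.2]
      rw [h3, h2]
      by_cases h4 : W.inter X = Z
      · rw [if_pos ⟨hW.1, hW.2, h4⟩, if_pos h4.symm, hsq, one_mul]
      · rw [if_neg fun h => h4 h.2.2, if_neg fun h => h4 h.symm, mul_zero, zero_mul]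
    · rw [if_neg fun h => hW ⟨h.1, h.2.1⟩, Finset.sum_eq_zero]
      intro U hU
      rw [if_neg fun h => hW ⟨(Finset.mem_filter.1 hU).2.1.trans h.1, h.2⟩, mul_zero]
  rw [Finset.sum_filter, Finset.sum_congr rfl fun W _ => h1 W, Finset.sum_comm]
  have h2 : ∀ U : A.Face, ∑ W : A.Face, (-1 : ℤ) ^ Z.dim * (-1) ^ U.dim *
      (if U.carrier ⊆ W.carrier ∧ W.carrier ⊆ C.carrier then (-1) ^ W.dim else 0) =
      if U = C then (-1) ^ Z.dim else 0 := by
    intro U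
    rw [← Finset.mul_sum, ← Finset.sum_filter]
    by_cases hU : U.carrier ⊆ C.carrier
    · rw [sum_neg_one_pow_dim_interval B hU]
      split_ifs
      · rw [mul_assoc, hsq, mul_one]
      · rw [mul_zero]
    · rw [Finset.filter_false_of_mem fun W _ h => hU (h.1.trans h.2), Finset.sum_empty, mul_zero,
        if_neg (by rintro rfl; exact hU subset_rfl)]
  rw [Finset.sum_congr rfl fun U _ => h2 U, Finset.sum_ite_eq']
  simp [hC]

/-! ### Summation of the candidate for the Möbius function -/

/-- The facial weak order, as a relation on faces. -/
def Face.WeakLE (B : A.Region) (F G : A.Face) : Prop :=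
  ∀ H, A.signMap B.point H * G.covector H ≤ A.signMap B.point H * F.covector H

theorem Face.WeakLE.trans {B : A.Region} {F G K : A.Face} (h : F.WeakLE B G) (h' : G.WeakLE B K) :
    F.WeakLE B K := fun H => (h' H).trans (h H)

/-- The condition under which the Möbius function does not vanish at `(X, Y)`. -/
def Face.MobiusNeZero (B : A.Region) (X Y : A.Face) : Prop :=
  X.WeakLE B (X.inter Y) ∧ (X.inter Y).WeakLE B Y ∧
    (X.inter Y).carrier = A.cell (A.reorient X.covector (X.inter Y).covector) ∩ Y.carrier

/-- The entrywise comparison behind `sum_neg_one_pow_dim_weakLE`. -/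
theorem sign_visible_iff_weakLE (b x y z : SignType) (hb : b ≠ 0) (hxy : b * y ≤ b * x)
    (h0 : x = 0 → y = 0) :
    ((z ≠ 0 → x = z) ∧ (x = (if y ≠ 0 then y else -x) → z = x)) ↔
      ((z ≠ 0 → x = z) ∧ (b * z ≤ b * x ∧ b * y ≤ b * z)) := by
  revert b x y z
  decide

open scoped Classical in
/-- The signed count of the faces of `X` in the interval `[X, Y]`, for `X < Y` with `Y` in the
linear span of `X`. These are the faces of `X` that avoid the walls not separating `X` from
`Y ∘ (-X)`. -/
theorem sum_neg_one_pow_dim_weakLE (B : A.Region) {X Y : A.Face} (hXY : X.WeakLE B Y)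
    (hne : X ≠ Y) (h0 : ∀ H, X.covector H = 0 → Y.covector H = 0) :
    ∑ Z : A.Face with Z.carrier ⊆ X.carrier ∧ X.WeakLE B Z ∧ Z.WeakLE B Y,
      (-1 : ℤ) ^ Z.dim = 0 := by
  obtain ⟨Y', hY'⟩ := Y.exists_comp_neg B X
  rw [← sum_neg_one_pow_dim_visible B (X := X) (Y := Y')]
  · refine Finset.sum_congr (Finset.filter_congr fun Z _ => ?_) fun _ _ => rfl
    simp only [Face.subset_iff, Face.WeakLE, ← forall_and]
    refine forall_congr' fun H => ?_
    rw [hY']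
    exact (sign_visible_iff_weakLE _ _ _ _ (signMap_ne_zero B.point_mem H) (hXY H) (h0 H)).symm
  · intro H
    have h1 := h0 H
    rw [hY']
    revert h1
    generalize X.covector H = x
    generalize Y.covector H = y
    revert x y
    decide
  · rintro rfl
    refine hne (Face.covector_injective (funext fun H => ?_))
    have h1 := h0 H
    have h2 := hY' H
    revert h1 h2
    generalize X.covector H = x
    generalize Y.covector H = y
    revert x y
    decide

theorem cell_reorient {X Z X' : A.Face} (hZX : Z.carrier ⊆ X.carrier)
    (hX' : ∀ H, X'.covector H = if Z.covector H ≠ 0 then Z.covector H else -X.covector H) :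
    A.cell (A.reorient X.covector Z.covector) = X'.carrier := by
  rw [X'.carrier_eq_cell]
  congr 1
  funext H
  have h := Face.subset_iff.1 hZX H
  rw [hX', reorient]
  by_cases h0 : Z.covector H = 0
  · rw [if_pos h0, if_neg (not_not.2 h0)]
  · rw [if_neg h0, if_pos h0, h h0]

/-- The faces `W` of the interval `[X, Y]` with `W ∩ X = Z` at which the candidate for the Möbius
function of the interval does not vanish: these are the faces of `Z ∘ Y` that meet `Z ∘ (-X)` only
in `Z`. -/
theorem Face.mobiusNeZero_iff {B : A.Region} {X Y Z W C X' : A.Face}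
    (hC : ∀ H, C.covector H = if Z.covector H ≠ 0 then Z.covector H else Y.covector H)
    (hX' : ∀ H, X'.covector H = if Z.covector H ≠ 0 then Z.covector H else -X.covector H) :
    ((X.WeakLE B W ∧ W.WeakLE B Y ∧ X.MobiusNeZero B W) ∧ X.inter W = Z) ↔
      (Z.carrier ⊆ X.carrier ∧ X.WeakLE B Z ∧ Z.WeakLE B Y) ∧
        (Z.carrier ⊆ W.carrier ∧ W.carrier ⊆ C.carrier ∧ W.inter X' = Z) := by
  constructor
  · rintro ⟨⟨-, hWY, hXZ, hZW, hcell⟩, rfl⟩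
    have hX : (X.inter W).carrier ⊆ X.carrier := Set.inter_subset_left
    have hW : (X.inter W).carrier ⊆ W.carrier := Set.inter_subset_right
    refine ⟨⟨hX, hXZ, hZW.trans hWY⟩, hW, Face.subset_iff.2 fun H => ?_, Face.ext' ?_⟩
    · have h1 := Face.subset_iff.1 hW H
      have h2 := hZW H
      have h3 := hWY H
      have hb := signMap_ne_zero B.point_mem H
      rw [hC]
      revert h1 h2 h3 hb
      generalize (X.inter W).covector H = z
      generalize W.covector H = w
      generalize Y.covector H = y
      generalize A.signMap B.point H = b
      revert z w y b
      decide
    · rw [hcell, cell_reorient hX hX', Set.inter_comm]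
      rfl
  · rintro ⟨⟨hX, hXZ, hZY⟩, hW, hWC, hWX'⟩
    have h : Z.WeakLE B W ∧ W.WeakLE B Y := by
      rw [Face.WeakLE, Face.WeakLE, ← forall_and]
      intro H
      have h1 := Face.subset_iff.1 hW H
      have h2 := Face.subset_iff.1 hWC H
      have h3 := hZY H
      rw [hC] at h2
      revert h1 h2 h3
      generalize Z.covector H = z
      generalize W.covector H = w
      generalize Y.covector H = y
      generalize A.signMap B.point H = b
      revert z w y b
      decide
    have hinter : X.inter W = Z := by
      refine Face.subset_antisymm (Face.subset_iff.2 fun H => ?_) (Set.subset_inter hX hW)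
      have h1 := (Face.subset_iff (F := X.inter W) (G := X)).1 Set.inter_subset_left H
      have h2 := (Face.subset_iff (F := X.inter W) (G := W)).1 Set.inter_subset_right H
      have h3 := Face.subset_iff.1 hX H
      have h4 := hXZ H
      have h5 := h.1 H
      have hb := signMap_ne_zero B.point_mem H
      intro hp
      rw [h1 hp] at h3 h4
      rw [h2 hp] at h5
      revert h3 h4 h5 hb hp
      generalize (X.inter W).covector H = p
      generalize Z.covector H = z
      generalize A.signMap B.point H = b
      revert p z b
      decide
    refine ⟨⟨hXZ.trans h.1, h.2, ?_⟩, hinter⟩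
    rw [Face.MobiusNeZero, hinter, cell_reorient hX hX']
    refine ⟨hXZ, h.1, ?_⟩
    rw [← hWX', Set.inter_comm]
    rfl

/-- `Z ∘ Y` is a face of `Z ∘ (-X)` precisely when `Y` lies in the linear span of `X`; this does not
depend on `Z`. -/
theorem Face.comp_subset_comp_neg_iff {B : A.Region} {X Y Z C X' : A.Face}
    (hC : ∀ H, C.covector H = if Z.covector H ≠ 0 then Z.covector H else Y.covector H)
    (hX' : ∀ H, X'.covector H = if Z.covector H ≠ 0 then Z.covector H else -X.covector H)
    (hX : Z.carrier ⊆ X.carrier) (hXZ : X.WeakLE B Z) (hZY : Z.WeakLE B Y) :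
    C.carrier ⊆ X'.carrier ↔ ∀ H, X.covector H = 0 → Y.covector H = 0 := by
  rw [Face.subset_iff]
  refine forall_congr' fun H => ?_
  have h1 := Face.subset_iff.1 hX H
  have h2 := hXZ H
  have h3 := hZY H
  have hb := signMap_ne_zero B.point_mem H
  rw [hC, hX']
  revert h1 h2 h3 hb
  generalize X.covector H = x
  generalize Y.covector H = y
  generalize Z.covector H = z
  generalize A.signMap B.point H = b
  revert x y z b
  decide

open scoped Classical in
/-- The defining recursion of the Möbius function for the candidate. Grouping the faces `W` by
`Z = W ∩ X`, each group contributes `(-1) ^ dim Z` if `Y` lies in the linear span of `X`, and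
nothing otherwise. -/
theorem sum_neg_one_pow_dim_mobiusNeZero (B : A.Region) {X Y : A.Face} (hXY : X.WeakLE B Y)
    (hne : X ≠ Y) :
    ∑ W : A.Face with X.WeakLE B W ∧ W.WeakLE B Y ∧ X.MobiusNeZero B W, (-1 : ℤ) ^ W.dim = 0 := by
  choose C hC using fun Z : A.Face => Z.exists_comp B Y
  choose X' hX' using fun Z : A.Face => Z.exists_comp_neg B X
  rw [← Finset.sum_fiberwise (g := fun W : A.Face => X.inter W)]
  simp only [Finset.filter_filter]
  have h1 : ∀ Z : A.Face, ∑ W : A.Face with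
      (X.WeakLE B W ∧ W.WeakLE B Y ∧ X.MobiusNeZero B W) ∧ X.inter W = Z, (-1 : ℤ) ^ W.dim =
      if Z.carrier ⊆ X.carrier ∧ X.WeakLE B Z ∧ Z.WeakLE B Y then
        if ∀ H, X.covector H = 0 → Y.covector H = 0 then (-1) ^ Z.dim else 0
      else 0 := by
    intro Z
    simp only [Face.mobiusNeZero_iff (hC Z) (hX' Z)]
    split_ifs with hZ h0
    · simp only [hZ, true_and]
      rw [sum_neg_one_pow_dim_inter_eq B,
        if_pos ((Face.comp_subset_comp_neg_iff (hC Z) (hX' Z) hZ.1 hZ.2.1 hZ.2.2).2 h0)]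
      · exact Face.subset_iff.2 fun H h => by rw [hC, if_pos h]
      · exact Face.subset_iff.2 fun H h => by rw [hX', if_pos h]
    · simp only [hZ, true_and]
      rw [sum_neg_one_pow_dim_inter_eq B,
        if_neg fun h => h0 ((Face.comp_subset_comp_neg_iff (hC Z) (hX' Z) hZ.1 hZ.2.1 hZ.2.2).1 h)]
      · exact Face.subset_iff.2 fun H h => by rw [hC, if_pos h]
      · exact Face.subset_iff.2 fun H h => by rw [hX', if_pos h]
    · simp only [hZ, false_and, Finset.filter_false, Finset.sum_empty]
  rw [Finset.sum_congr rfl fun Z _ => h1 Z, ← Finset.sum_filter]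
  by_cases h0 : ∀ H, X.covector H = 0 → Y.covector H = 0
  · simp only [if_pos h0]
    exact sum_neg_one_pow_dim_weakLE B hXY hne h0
  · simp only [if_neg h0, Finset.sum_const_zero]

theorem Face.mobiusNeZero_self (B : A.Region) (X : A.Face) : X.MobiusNeZero B X := by
  have hX : X.inter X = X := Face.ext' (Set.inter_self _)
  have h : A.reorient X.covector X.covector = X.covector := by
    funext H
    rw [reorient]
    split_ifs with h
    · rw [h, neg_zero]
    · rfl
  rw [Face.MobiusNeZero, hX, h, ← X.carrier_eq_cell, Set.inter_self]
  exact ⟨fun _ => le_rfl, fun _ => le_rfl, rfl⟩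

open scoped Classical in
theorem facialMobius_eq (B : A.Region) {X Y : A.FacialWeakOrder B} (hXY : X ≤ Y) :
    A.facialMobius B X Y =
      if Face.MobiusNeZero B X Y then (-1) ^ (Face.dim X + Face.dim Y) else 0 := by
  have hle : ∀ {F G : A.FacialWeakOrder B}, F ≤ G ↔ Face.WeakLE B F G := facialWeakOrder_le_iff
  let _ : Fintype (A.FacialWeakOrder B) := Fintype.ofFinite _
  let _ : LocallyFiniteOrder (A.FacialWeakOrder B) := Fintype.toLocallyFiniteOrder
  refine IncidenceAlgebra.mu_eq_of_sum_Icc (P := A.FacialWeakOrder B)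
    (fun X Y => if Face.MobiusNeZero B X Y then (-1) ^ (Face.dim X + Face.dim Y) else 0)
    (fun X => ?_) (fun X Y hlt => ?_) hXY
  · rw [if_pos (Face.mobiusNeZero_self B X), ← two_mul, pow_mul, neg_one_sq, one_pow]
  · have h := sum_neg_one_pow_dim_mobiusNeZero B (hle.1 hlt.le) hlt.ne
    have hIcc : ∀ g : A.Face → ℤ, ∑ W ∈ Finset.Icc X Y, g W =
        ∑ W : A.Face with Face.WeakLE B X W ∧ Face.WeakLE B W Y, g W := fun g =>
      Finset.sum_bij (fun W _ => W)
        (fun W hW => Finset.mem_filter.2 ⟨Finset.mem_univ _, by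
          rwa [Finset.mem_Icc, hle, hle] at hW⟩)
        (fun _ _ _ _ h => h)
        (fun W hW => ⟨W, by
          rw [Finset.mem_filter] at hW
          exact Finset.mem_Icc.2 ⟨hle.2 hW.2.1, hle.2 hW.2.2⟩, rfl⟩)
        (fun _ _ => rfl)
    refine (hIcc _).trans ?_
    simp only [pow_add, ← mul_ite_zero, ← Finset.mul_sum]
    rw [← Finset.sum_filter, Finset.filter_filter]
    simp only [and_assoc]
    rw [h, mul_zero]

end HyperplaneArrangement

theorem mainTheorem7 {V : Type*} [NormedAddCommGroup V] [InnerProductSpace ℝ V]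
    [FiniteDimensional ℝ V] (A : HyperplaneArrangement V) (B : A.Region)
    (X Y Z : A.FacialWeakOrder B) (hXY : X ≤ Y) (hZ : Z = HyperplaneArrangement.Face.inter X Y) :
    ((X ≤ Z ∧ Z ≤ Y ∧ Z.carrier = A.cell (A.reorient X.covector Z.covector) ∩ Y.carrier) →
      A.facialMobius B X Y = (-1) ^ (X.dim + Y.dim)) ∧
    (¬ (X ≤ Z ∧ Z ≤ Y ∧ Z.carrier = A.cell (A.reorient X.covector Z.covector) ∩ Y.carrier) →
      A.facialMobius B X Y = 0) := by
  have h : (X ≤ Z ∧ Z ≤ Y ∧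
      Z.carrier = A.cell (A.reorient X.covector Z.covector) ∩ Y.carrier) ↔
        HyperplaneArrangement.Face.MobiusNeZero B X Y := by
    rw [HyperplaneArrangement.facialWeakOrder_le_iff, HyperplaneArrangement.facialWeakOrder_le_iff]
    subst hZ
    rfl
  rw [h, HyperplaneArrangement.facialMobius_eq B hXY]
  exact ⟨fun h => if_pos h, fun h => if_neg h⟩
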